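/- Consider modal formulas built from countably many propositional variables $p_0,p_1,\dots$ with $\bot$, $\to$, a unary modality $\Box$ and a binary modality $\rhd$; $\neg,\wedge,\vee$ are the usual abbreviations and $\Diamond A:=\neg\Box\neg A$. The logic $\mathbf{IL}$ is the smallest set of formulas that contains all instances of propositional tautologies and all instances of the schemes $$\begin{array}{ll} \mathsf{L1}: \Box(A\to B)\to(\Box A\to\Box B), & \mathsf{L2}: \Box A\to\Box\Box A,\\ \mathsf{L3}: \Box(\Box A\to A)\to\Box A, & \mathsf{J1}: \Box(A\to B)\to (A\rhd B),\\ \mathsf{J2}: (A\rhd B)\wedge(B\rhd C)\to (A\rhd C), & \mathsf{J3}: (A\rhd C)\wedge(B\rhd C)\to ((A\vee B)\rhd C),\\ \mathsf{J4}: (A\rhd B)\to(\Diamond A\to\Diamond B), & \mathsf{J5}: \Diamond A\rhd A, \end{array}$$ and is closed under modus ponens and necessitation (from $A$ infer $\Box A$). For an axiom scheme $\mathsf X$, $\mathbf{IL}\mathsf X$ is obtained by adding all instances of $\mathsf X$ as axioms, with the same rules. Let $$\begin{array}{ll} \mathsf{M}_0: & (A\rhd B)\to\big((\Diamond A\wedge\Box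 C)\rhd (B\wedge\Box C)\big),\\ \mathsf{W}^*: & (A\rhd B)\to\big((B\wedge\Box C)\rhd (B\wedge\Box C\wedge\Box\neg A)\big),\\ \mathsf{P}_0: & (A\rhd\Diamond B)\to\Box(A\rhd B),\\ \mathsf{R}: & (A\rhd B)\to\big(\neg(A\rhd\neg C)\rhd (B\wedge\Box C)\big). \end{array}$$ Corollary. Each of the logics $\mathbf{IL}\mathsf{M}_0$, $\mathbf{IL}\mathsf{W}^*$, $\mathbf{IL}\mathsf{P}_0$ and $\mathbf{IL}\mathsf{R}$ is decidable: for each of them there is an algorithm (a total recursive function on Gödel numbers of formulas) that decides whether a given formula is a theorem of the logic. -/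

import Mathlib

namespace IntLogic

/-- Formulas of interpretability logic: propositional variables `p₀, p₁, …`, the falsum `⊥`,
implication, the unary modality `□` and the binary modality `▷`. -/
inductive Formula : Type
  | var : ℕ → Formula
  | bot : Formula
  | imp : Formula → Formula → Formula
  | box : Formula → Formula
  | rhd : Formula → Formula → Formula

namespace Formula

/-- `¬ A` -/
def neg (A : Formula) : Formula := A.imp bot

/-- `A ∨ B` -/
def or (A B : Formula) : Formula := A.neg.imp B

/-- `A ∧ B` -/
def and (A B : Formula) : Formula := (A.imp B.neg).neg

/-- `◇ A` -/
def dia (A : Formula) : Formula := A.neg.box.neg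

/-- Classical truth value of a formula under an assignment `v` of truth values to the formulas that
are not built by a propositional connective (variables, `□ A` and `A ▷ B` are treated as atoms). -/
def propEval (v : Formula → Prop) : Formula → Prop
  | var n => v (var n)
  | bot => False
  | imp A B => propEval v A → propEval v B
  | box A => v (box A)
  | rhd A B => v (rhd A B)

/-- `A` is (a modal substitution instance of) a propositional tautology. -/
def IsTautology (A : Formula) : Prop := ∀ v : Formula → Prop, propEval v A

/-- The Gödel number of a formula. -/
def toNat : Formula → ℕ
  | bot => 0
  | var n => 4 * n + 1
  | box A => 4 * toNat A + 2
  | imp A B => 4 * Nat.pair (toNat A) (toNat B) + 3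
  | rhd A B => 4 * Nat.pair (toNat A) (toNat B) + 4

/-- The formula with a given Gödel number. -/
def ofNat : ℕ → Formula
  | 0 => bot
  | n + 1 =>
    have h₀ : n / 4 < n + 1 := Nat.lt_succ_of_le (Nat.div_le_self n 4)
    have h₁ : (n / 4).unpair.1 < n + 1 := lt_of_le_of_lt (Nat.unpair_left_le _) h₀
    have h₂ : (n / 4).unpair.2 < n + 1 := lt_of_le_of_lt (Nat.unpair_right_le _) h₀
    match n % 4 with
    | 0 => var (n / 4)
    | 1 => box (ofNat (n / 4))
    | 2 => imp (ofNat (n / 4).unpair.1) (ofNat (n / 4).unpair.2)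
    | _ => rhd (ofNat (n / 4).unpair.1) (ofNat (n / 4).unpair.2)

theorem ofNat_toNat (A : Formula) : ofNat (toNat A) = A := by
  induction A with
  | bot => simp [toNat, ofNat]
  | var n =>
    have h1 : (4 * n) % 4 = 0 := by omega
    have h2 : (4 * n) / 4 = n := by omega
    simp only [toNat, ofNat, h1, h2]
  | box A ih =>
    have h1 : (4 * toNat A + 1) % 4 = 1 := by omega
    have h2 : (4 * toNat A + 1) / 4 = toNat A := by omega
    simp only [toNat, ofNat, h1, h2, ih]
  | imp A B ihA ihB =>
    have h1 : (4 * Nat.pair (toNat A) (toNat B) + 2) % 4 = 2 := by omega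
    have h2 : (4 * Nat.pair (toNat A) (toNat B) + 2) / 4 = Nat.pair (toNat A) (toNat B) := by omega
    simp only [toNat, ofNat, h1, h2, Nat.unpair_pair, ihA, ihB]
  | rhd A B ihA ihB =>
    have h1 : (4 * Nat.pair (toNat A) (toNat B) + 3) % 4 = 3 := by omega
    have h2 : (4 * Nat.pair (toNat A) (toNat B) + 3) / 4 = Nat.pair (toNat A) (toNat B) := by omega
    simp only [toNat, ofNat, h1, h2, Nat.unpair_pair, ihA, ihB]

theorem toNat_ofNat (n : ℕ) : toNat (ofNat n) = n := by
  induction n using Nat.strong_induction_on with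
  | _ n ih =>
    cases n with
    | zero => simp [toNat, ofNat]
    | succ n =>
      have h₀ : n / 4 < n + 1 := Nat.lt_succ_of_le (Nat.div_le_self n 4)
      have h₁ : (n / 4).unpair.1 < n + 1 := lt_of_le_of_lt (Nat.unpair_left_le _) h₀
      have h₂ : (n / 4).unpair.2 < n + 1 := lt_of_le_of_lt (Nat.unpair_right_le _) h₀
      have h4 : n % 4 < 4 := Nat.mod_lt _ (by norm_num)
      have hd := Nat.div_add_mod n 4
      rw [ofNat]
      generalize hr : n % 4 = r at h4 hd
      interval_cases r
      · simp only [toNat]; omega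
      · simp only [toNat, ih _ h₀]; omega
      · simp only [toNat, ih _ h₁, ih _ h₂, Nat.pair_unpair]; omega
      · simp only [toNat, ih _ h₁, ih _ h₂, Nat.pair_unpair]; omega

/-- Formulas are coded by natural numbers through the Gödel numbering `toNat`; computability of sets
of formulas refers to this coding. -/
instance : Denumerable Formula := Denumerable.mk' ⟨toNat, ofNat, ofNat_toNat, toNat_ofNat⟩

end Formula

open Formula

/-- Derivability in the logic that extends **IL** by the set `X` of additional axioms (in the
applications: all instances of an axiom scheme). -/
inductive Provable (X : Set Formula) : Formula → Prop
  | taut {A : Formula} : A.IsTautology → Provable X A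
  /-- `□(A → B) → (□A → □B)` -/
  | L1 (A B : Formula) : Provable X ((A.imp B).box.imp (A.box.imp B.box))
  /-- `□A → □□A` -/
  | L2 (A : Formula) : Provable X (A.box.imp A.box.box)
  /-- `□(□A → A) → □A` -/
  | L3 (A : Formula) : Provable X ((A.box.imp A).box.imp A.box)
  /-- `□(A → B) → A ▷ B` -/
  | J1 (A B : Formula) : Provable X ((A.imp B).box.imp (A.rhd B))
  /-- `(A ▷ B) ∧ (B ▷ C) → A ▷ C` -/
  | J2 (A B C : Formula) : Provable X (((A.rhd B).and (B.rhd C)).imp (A.rhd C))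
  /-- `(A ▷ C) ∧ (B ▷ C) → (A ∨ B) ▷ C` -/
  | J3 (A B C : Formula) : Provable X (((A.rhd C).and (B.rhd C)).imp ((A.or B).rhd C))
  /-- `A ▷ B → (◇A → ◇B)` -/
  | J4 (A B : Formula) : Provable X ((A.rhd B).imp (A.dia.imp B.dia))
  /-- `◇A ▷ A` -/
  | J5 (A : Formula) : Provable X (A.dia.rhd A)
  | ax {A : Formula} : A ∈ X → Provable X A
  /-- Modus ponens. -/
  | mp {A B : Formula} : Provable X (A.imp B) → Provable X A → Provable X B
  /-- Necessitation. -/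
  | nec {A : Formula} : Provable X A → Provable X A.box

/-- The logic **IL**`X`, as its set of theorems. -/
def IL (X : Set Formula) : Set Formula := {A | Provable X A}

/-- The scheme `A ▷ B → (◇A ∧ □C) ▷ (B ∧ □C)`. -/
def schemeM₀ : Set Formula :=
  {F | ∃ A B C : Formula,
    F = (A.rhd B).imp ((A.dia.and C.box).rhd (B.and C.box))}

/-- The scheme `A ▷ B → (B ∧ □C) ▷ (B ∧ □C ∧ □¬A)`. -/
def schemeWstar : Set Formula :=
  {F | ∃ A B C : Formula,
    F = (A.rhd B).imp ((B.and C.box).rhd ((B.and C.box).and A.neg.box))}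

/-- The scheme `A ▷ ◇B → □(A ▷ B)`. -/
def schemeP₀ : Set Formula :=
  {F | ∃ A B : Formula, F = (A.rhd B.dia).imp (A.rhd B).box}

/-- The scheme `A ▷ B → ¬(A ▷ ¬C) ▷ (B ∧ □C)`. -/
def schemeR : Set Formula :=
  {F | ∃ A B C : Formula,
    F = (A.rhd B).imp ((A.rhd C.neg).neg.rhd (B.and C.box))}

/-- A logic (a set of formulas) is decidable if membership in it is decided by an algorithm, that
is, by a total recursive function on Gödel numbers. -/
def IsDecidable (L : Set Formula) : Prop := ComputablePred fun A : Formula => A ∈ L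

end IntLogic

/-! Each logic has a finite model property with a computable bound, proved with algebras rather than
Kripke-style frames. Let `A` have Gödel number `a`, and let `δ` say that some formula with code at
most `a`, or the negation of one, holds now and at no later world. By Löb's axiom and J5,
restricting `□` and `▷` to `δ`-worlds does not change `A` (`provable_rel_iff`). A chain of
`δ`-worlds uses up a new formula of the finite list at each world, so `□ⁿ⊥` relativised to `δ` is
provable for `n = 2 * a + 3` (`provable_rel_boxIter`). Relativisation sends theorems to theorems
(`provable_rel`), so adding `□ⁿ⊥`, and `¬pᵢ` for `i > a`, as axioms does not affect whether `A` is
provable (`provable_bounded_iff`). With these axioms only boundedly many formulas exist up to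
equivalence (`exists_classes`), so a non-theorem is refuted in a finite Lindenbaum algebra
(`exists_model`). Conversely, finite models are sound (`Alg.IsModel.eval_eq_top`). Validity in all
models of bounded size is primitive recursive once algebras and evaluations are coded by numbers. -/

namespace IntLogic

open Formula

/-! ### Propositional evaluation and derived rules of **IL**. -/

namespace Formula

variable (v : Formula → Prop) (A B : Formula)

@[grind =]
theorem propEval_imp : propEval v (A.imp B) ↔ (propEval v A → propEval v B) := Iff.rfl

@[grind =]
theorem propEval_bot : propEval v bot ↔ False := Iff.rfl

@[grind =]
theorem propEval_box : propEval v A.box ↔ v A.box := Iff.rfl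

@[grind =]
theorem propEval_rhd : propEval v (A.rhd B) ↔ v (A.rhd B) := Iff.rfl

@[grind =]
theorem propEval_neg : propEval v A.neg ↔ ¬ propEval v A := Iff.rfl

@[grind =]
theorem propEval_and : propEval v (A.and B) ↔ propEval v A ∧ propEval v B := by
  simp only [Formula.and, neg, propEval]; tauto

@[grind =]
theorem propEval_or : propEval v (A.or B) ↔ propEval v A ∨ propEval v B := by
  simp only [Formula.or, neg, propEval]; tauto

@[grind =]
theorem propEval_dia : propEval v A.dia ↔ ¬ v A.neg.box := Iff.rfl

end Formula

namespace Provable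

variable {X : Set Formula} {A B C D E : Formula}

theorem of_taut (h : Provable X A) (t : (A.imp B).IsTautology) : Provable X B :=
  (taut t).mp h

theorem of_taut₂ (h₁ : Provable X A) (h₂ : Provable X B) (t : (A.imp (B.imp C)).IsTautology) :
    Provable X C :=
  (h₁.of_taut t).mp h₂

theorem of_taut₃ (h₁ : Provable X A) (h₂ : Provable X B) (h₃ : Provable X C)
    (t : (A.imp (B.imp (C.imp D))).IsTautology) : Provable X D :=
  (h₁.of_taut₂ h₂ t).mp h₃

theorem of_taut₄ (h₁ : Provable X A) (h₂ : Provable X B) (h₃ : Provable X C) (h₄ : Provable X D)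
    (t : (A.imp (B.imp (C.imp (D.imp E)))).IsTautology) : Provable X E :=
  (h₁.of_taut₃ h₂ h₃ t).mp h₄

theorem box_mono (h : Provable X (A.imp B)) : Provable X (A.box.imp B.box) :=
  (L1 A B).mp h.nec

theorem box_mono₂ (h : Provable X (A.imp (B.imp C))) :
    Provable X (A.box.imp (B.box.imp C.box)) :=
  h.box_mono.of_taut₂ (L1 B C) (fun v => by grind)

theorem box_mono_of_box (h : Provable X (A.box.imp (A.imp B))) :
    Provable X (A.box.imp B.box) :=
  h.box_mono₂.of_taut₂ (L2 A) (fun v => by grind)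

theorem rhd_mono {A' B' : Formula} (hA : Provable X (A'.imp A)) (hB : Provable X (B.imp B')) :
    Provable X ((A.rhd B).imp (A'.rhd B')) := by
  have h : Provable X ((A.rhd B).imp (A'.rhd B)) :=
    ((J1 _ _).mp hA.nec).of_taut₂ (J2 A' A B) fun v => by grind
  exact ((J1 _ _).mp hB.nec).of_taut₃ (J2 A' B B') h fun v => by grind

/-- `A ▷ A ∧ □¬A` -/
theorem rhd_and_box_neg (A : Formula) : Provable X (A.rhd (A.and A.neg.box)) := by
  set M := A.and A.neg.box with hM
  -- `¬M` is propositionally `□¬A → ¬A`, so this is Löb's axiom for `¬A`.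
  have h1 : Provable X (M.neg.box.imp A.neg.box) := by
    have : Provable X (M.neg.box.imp (A.neg.box.imp A.neg).box) :=
      box_mono (taut (fun v => by grind))
    exact this.of_taut₂ (L3 A.neg) (fun v => by grind)
  -- Now J5 gives `◇M ▷ M`, and J3 joins it with `M ▷ M`.
  have h2 : Provable X (A.imp (M.or M.dia)) :=
    h1.of_taut (fun v => by grind)
  have h3 : Provable X (M.rhd M) :=
    (J1 M M).mp (nec (taut (fun v => by grind)))
  have h4 : Provable X ((M.or M.dia).rhd M) :=
    h3.of_taut₃ (J5 M) (J3 M M.dia M) (fun v => by grind)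
  exact ((J1 _ _).mp h2.nec).of_taut₃ h4 (J2 A (M.or M.dia) M)
    (fun v => by grind)

end Provable

/-! ### Relativisation to the worlds satisfying `δ`. -/

namespace Formula

/-- The disjunction of a list of formulas. -/
def disj : List Formula → Formula
  | [] => bot
  | A :: l => A.or (disj l)

theorem propEval_disj (v : Formula → Prop) (l : List Formula) :
    propEval v (disj l) ↔ ∃ A ∈ l, propEval v A := by
  induction l with
  | nil => simp [disj, propEval]
  | cons A l ih =>
    simp only [disj, propEval_or, ih, List.mem_cons, exists_eq_or_imp]

/-- `A` holds but fails at all later worlds. -/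
def last (A : Formula) : Formula := A.and A.neg.box

/-- The iterated box `□ⁿ A`. -/
def boxIter : ℕ → Formula → Formula
  | 0, A => A
  | n + 1, A => (boxIter n A).box

/-- Relativisation of a formula to the worlds satisfying `δ`; variables with index at least `k`
are replaced by `⊥`. -/
def rel (k : ℕ) (δ : Formula) : Formula → Formula
  | var i => if i < k then var i else bot
  | bot => bot
  | imp A B => (rel k δ A).imp (rel k δ B)
  | box A => (δ.imp (rel k δ A)).box
  | rhd A B => ((rel k δ A).and δ).rhd ((rel k δ B).and δ)

@[grind =]
theorem rel_neg (k : ℕ) (δ A : Formula) : rel k δ A.neg = (rel k δ A).neg := rfl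

@[grind =]
theorem rel_and (k : ℕ) (δ A B : Formula) :
    rel k δ (A.and B) = (rel k δ A).and (rel k δ B) := rfl

@[grind =]
theorem rel_or (k : ℕ) (δ A B : Formula) : rel k δ (A.or B) = (rel k δ A).or (rel k δ B) := rfl

@[grind =]
theorem rel_dia (k : ℕ) (δ A : Formula) :
    rel k δ A.dia = (δ.imp (rel k δ A).neg).box.neg := rfl

theorem propEval_rel (k : ℕ) (δ : Formula) (v : Formula → Prop) (A : Formula) :
    propEval v (rel k δ A) ↔ propEval (fun B => propEval v (rel k δ B)) A := by
  induction A with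
  | imp A B ihA ihB => simp only [rel, propEval, ihA, ihB]
  | _ => simp only [propEval, rel]

theorem IsTautology.rel {A : Formula} (h : A.IsTautology) (k : ℕ) (δ : Formula) :
    (rel k δ A).IsTautology := fun v => (propEval_rel k δ v A).2 (h _)

end Formula

/-- The extra axioms that bound the depth of worlds by `n` and make the variables with index at
least `k` false. -/
def bounded (X : Set Formula) (n k : ℕ) : Set Formula :=
  X ∪ {F | F = boxIter n bot ∨ ∃ i, k ≤ i ∧ F = (var i).neg}

theorem Provable.dia_and {X : Set Formula} (A B : Formula) :
    Provable X ((B.imp A.neg).box.neg.imp (A.and B).dia) :=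
  (Provable.box_mono (A := (A.and B).neg) (B := B.imp A.neg)
    (.taut fun v => by grind)).of_taut fun v => by grind

theorem Provable.dia_of_dia_and {X : Set Formula} (A B : Formula) :
    Provable X ((A.and B).dia.imp (B.imp A.neg).box.neg) :=
  (Provable.box_mono (B := (A.and B).neg) (A := B.imp A.neg)
    (.taut fun v => by grind)).of_taut fun v => by grind

/-- Induction on derivations. The relativised **IL** axioms are, up to monotonicity, instances of
the same axioms for `a ∧ δ` or `δ → a`. The extra axioms `¬pᵢ` become `¬⊥`, because `rel` erases the
variables from `k` on. -/
theorem provable_rel {X : Set Formula} {n k : ℕ} {δ : Formula}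
    (hX : ∀ F ∈ X, Provable X (rel k δ F)) (hn : Provable X (rel k δ (boxIter n bot)))
    {A : Formula} (h : Provable (bounded X n k) A) : Provable X (rel k δ A) := by
  induction h with
  | taut h => exact .taut (h.rel k δ)
  | L1 A B =>
    simp only [rel]
    exact Provable.box_mono₂ (.taut fun v => by grind)
  | L2 A =>
    simp only [rel]
    generalize rel k δ A = a
    have h : Provable X ((δ.imp a).box.box.imp (δ.imp (δ.imp a).box).box) :=
      .box_mono (.taut fun v => by grind)
    exact h.of_taut₂ (.L2 (δ.imp a)) fun v => by grind
  | L3 A =>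
    simp only [rel]
    generalize rel k δ A = a
    have h : Provable X ((δ.imp ((δ.imp a).box.imp a)).box.imp ((δ.imp a).box.imp (δ.imp a)).box) :=
      .box_mono (.taut fun v => by grind)
    exact h.of_taut₂ (.L3 (δ.imp a)) fun v => by grind
  | J1 A B =>
    simp only [rel]
    generalize rel k δ A = a, rel k δ B = b
    have h : Provable X ((δ.imp (a.imp b)).box.imp ((a.and δ).imp (b.and δ)).box) :=
      .box_mono (.taut fun v => by grind)
    exact h.of_taut₂ (.J1 (a.and δ) (b.and δ)) fun v => by grind
  | J2 A B C => exact .J2 _ _ _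
  | J3 A B C =>
    simp only [rel, rel_and, rel_or]
    generalize rel k δ A = a, rel k δ B = b, rel k δ C = c
    have h : Provable X
        ((((a.and δ).or (b.and δ)).rhd (c.and δ)).imp (((a.or b).and δ).rhd (c.and δ))) :=
      .rhd_mono (.taut fun v => by grind) (.taut fun v => by grind)
    exact h.of_taut₂ (.J3 (a.and δ) (b.and δ) (c.and δ)) fun v => by grind
  | J4 A B =>
    simp only [rel, rel_dia]
    generalize rel k δ A = a, rel k δ B = b
    exact (Provable.dia_and a δ).of_taut₃ (.dia_of_dia_and b δ) (.J4 (a.and δ) (b.and δ))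
      fun v => by grind
  | J5 A =>
    simp only [rel, rel_dia]
    generalize rel k δ A = a
    exact (Provable.rhd_mono ((Provable.dia_and a δ).of_taut fun v => by grind)
      (.taut fun v => by grind)).mp (.J5 (a.and δ))
  | ax h =>
    rcases h with h | rfl | ⟨i, hi, rfl⟩
    · exact hX _ h
    · exact hn
    · simp only [rel_neg, rel, not_lt.2 hi, if_false]
      exact .taut fun v => by grind
  | mp _ _ ih₁ ih₂ => exact ih₁.mp ih₂
  | nec _ ih => exact .nec (ih.of_taut fun v => by grind)

/-! ### The four schemes are preserved under relativisation: use the instance for `a ∧ δ`, `b ∧ δ`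
and, where a third formula occurs, `δ → c`. -/

theorem provable_rel_of_mem_schemeM₀ (k : ℕ) (δ : Formula) :
    ∀ F ∈ schemeM₀, Provable schemeM₀ (rel k δ F) := by
  rintro _ ⟨A, B, C, rfl⟩
  simp only [rel, rel_dia, rel_and]
  generalize rel k δ A = a, rel k δ B = b, rel k δ C = c
  have h : Provable schemeM₀
      ((((a.and δ).dia.and (δ.imp c).box).rhd ((b.and δ).and (δ.imp c).box)).imp
        ((((δ.imp a.neg).box.neg.and (δ.imp c).box).and δ).rhd ((b.and (δ.imp c).box).and δ))) :=
    .rhd_mono ((Provable.dia_and a δ).of_taut fun v => by grind) (.taut fun v => by grind)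
  exact h.of_taut₂ (.ax ⟨a.and δ, b.and δ, δ.imp c, rfl⟩) fun v => by grind

theorem provable_rel_of_mem_schemeWstar (k : ℕ) (δ : Formula) :
    ∀ F ∈ schemeWstar, Provable schemeWstar (rel k δ F) := by
  rintro _ ⟨A, B, C, rfl⟩
  simp only [rel, rel_and, rel_neg]
  generalize rel k δ A = a, rel k δ B = b, rel k δ C = c
  have h : Provable schemeWstar
      ((((b.and δ).and (δ.imp c).box).rhd
          (((b.and δ).and (δ.imp c).box).and (a.and δ).neg.box)).imp
        (((b.and (δ.imp c).box).and δ).rhd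
          (((b.and (δ.imp c).box).and (δ.imp a.neg).box).and δ))) :=
    .rhd_mono (.taut fun v => by grind)
      ((Provable.dia_and a δ).of_taut fun v => by grind)
  exact h.of_taut₂ (.ax ⟨a.and δ, b.and δ, δ.imp c, rfl⟩) fun v => by grind

theorem provable_rel_of_mem_schemeP₀ (k : ℕ) (δ : Formula) :
    ∀ F ∈ schemeP₀, Provable schemeP₀ (rel k δ F) := by
  rintro _ ⟨A, B, rfl⟩
  simp only [rel, rel_dia]
  generalize rel k δ A = a, rel k δ B = b
  have h₁ : Provable schemeP₀
      (((a.and δ).rhd ((δ.imp b.neg).box.neg.and δ)).imp ((a.and δ).rhd (b.and δ).dia)) :=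
    .rhd_mono (.taut fun v => by grind) ((Provable.dia_and b δ).of_taut fun v => by grind)
  have h₂ : Provable schemeP₀
      (((a.and δ).rhd (b.and δ)).box.imp (δ.imp ((a.and δ).rhd (b.and δ))).box) :=
    .box_mono (.taut fun v => by grind)
  exact h₁.of_taut₃ h₂ (.ax ⟨a.and δ, b.and δ, rfl⟩) fun v => by grind

theorem provable_rel_of_mem_schemeR (k : ℕ) (δ : Formula) :
    ∀ F ∈ schemeR, Provable schemeR (rel k δ F) := by
  rintro _ ⟨A, B, C, rfl⟩
  simp only [rel, rel_and, rel_neg]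
  generalize rel k δ A = a, rel k δ B = b, rel k δ C = c
  have h₁ : Provable schemeR
      (((a.and δ).rhd (δ.imp c).neg).imp ((a.and δ).rhd (c.neg.and δ))) :=
    .rhd_mono (.taut fun v => by grind) (.taut fun v => by grind)
  have h₂ : Provable schemeR
      ((((a.and δ).rhd (δ.imp c).neg).neg.rhd ((b.and δ).and (δ.imp c).box)).imp
        ((((a.and δ).rhd (c.neg.and δ)).neg.and δ).rhd ((b.and (δ.imp c).box).and δ))) :=
    .rhd_mono (h₁.of_taut fun v => by grind) (.taut fun v => by grind)
  exact h₂.of_taut₂ (.ax ⟨a.and δ, b.and δ, δ.imp c, rfl⟩) fun v => by grind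

/-! ### Bounded depth, and invariance of small formulas under relativisation. -/

/-- Worlds of depth bounded by the length of `l`: if all `δ`-successors satisfy some formula of `l`
for the last time, then the relativised `□ⁿ⊥` holds. -/
theorem provable_rel_boxIter_aux {X : Set Formula} {k : ℕ} {δ : Formula} :
    ∀ (n : ℕ) (l : List Formula), l.length < n →
      Provable X ((δ.imp (disj (l.map last))).box.imp (rel k δ (boxIter n bot))) := by
  intro n
  induction n with
  | zero => intro l hl; omega
  | succ n ih =>
    intro l hl
    refine Provable.box_mono_of_box ?_
    set H := δ.imp (disj (l.map last)) with hH
    set R := rel k δ (boxIter n bot)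
    have step : ∀ G ∈ l, Provable X (H.box.imp ((last G).imp R)) := by
      intro G hG
      obtain ⟨s, t, rfl⟩ := List.append_of_mem hG
      -- Beyond a world where `G` holds for the last time, `G` cannot be the witness in `H`. It is
      -- dropped from the list, and the induction hypothesis applies to the shorter one.
      have h₁ : Provable X (H.imp (G.neg.imp (δ.imp (disj ((s ++ t).map last))))) := by
        refine .taut fun v => ?_
        simp only [hH, propEval_imp, propEval_disj, propEval_neg, List.mem_map]
        rintro h hG hδ
        obtain ⟨_, ⟨F, hF, rfl⟩, hv⟩ := h hδ
        refine ⟨_, ⟨F, ?_, rfl⟩, hv⟩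
        have : F ≠ G := by
          rintro rfl
          exact hG ((propEval_and v _ _).1 hv).1
        simp only [List.mem_append, List.mem_cons] at hF ⊢
        tauto
      have h₂ := ih (s ++ t) (by simp at hl ⊢; omega)
      refine h₁.box_mono₂.of_taut₂ h₂ fun v => ?_
      simp only [last]
      grind
    -- The case distinction over the disjunction runs through a separate list `m`, since `H` must
    -- keep mentioning all of `l`.
    suffices h : ∀ m : List Formula, (∀ G ∈ m, G ∈ l) →
        Provable X (H.box.imp ((disj (m.map last)).imp R)) from
      (h l fun _ h => h).of_taut fun v => by
        simp only [hH]; grind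
    intro m
    induction m with
    | nil => intro _; exact .taut fun v => by simp [disj, propEval]
    | cons G m ihm =>
      intro hm
      exact (step G (hm G (by simp))).of_taut₂ (ihm fun F hF => hm F (by simp [hF]))
        fun v => by simp only [List.map_cons, disj]; grind

theorem provable_rel_boxIter {X : Set Formula} (k : ℕ) (l : List Formula) :
    Provable X (rel k (disj (l.map last)) (boxIter (l.length + 1) bot)) :=
  (provable_rel_boxIter_aux _ l (Nat.lt_succ_self _)).mp (.nec (.taut fun _ => id))

/-- Follows from `G ▷ G ∧ □¬G`; with it, both arguments of `▷` can be cut down to `δ`-worlds. -/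
theorem provable_rhd_and_last {X : Set Formula} {G : Formula} {l : List Formula} (h : G ∈ l) :
    Provable X (G.rhd (G.and (disj (l.map last)))) := by
  refine (Provable.rhd_mono (.taut fun v => id) (.taut fun v => ?_)).mp (.rhd_and_box_neg G)
  intro hv
  rw [propEval_and, propEval_disj]
  exact ⟨((propEval_and v _ _).1 hv).1, _, List.mem_map_of_mem h, hv⟩

/-- A failure of `G` at a later world yields a last failure, which lies in the disjunction because
`¬G` is listed. Formally this is Löb's axiom for `G`. -/
theorem provable_box_of_box_last {X : Set Formula} {G : Formula} {l : List Formula}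
    (h : G.neg ∈ l) : Provable X (((disj (l.map last)).imp G).box.imp G.box) := by
  have h₁ : Provable X (((disj (l.map last)).imp G).imp (G.neg.neg.box.imp G)) := by
    refine .taut fun v => ?_
    simp only [propEval_imp, propEval_disj]
    intro h₁ h₂
    by_contra hG
    exact hG (h₁ ⟨_, List.mem_map_of_mem h, (propEval_and v _ _).2 ⟨hG, h₂⟩⟩)
  have h₂ : Provable X (G.box.imp G.neg.neg.box) := .box_mono (.taut fun v => by grind)
  have h₃ : Provable X (((disj (l.map last)).imp G).imp (G.box.imp G)) :=
    h₁.of_taut₂ h₂ fun v => by grind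
  exact h₃.box_mono.of_taut₂ (.L3 G) fun v => by grind

/-- Biconditional of formulas. -/
def Formula.iff (A B : Formula) : Formula := (A.imp B).and (B.imp A)

@[grind =]
theorem Formula.propEval_iff (v : Formula → Prop) (A B : Formula) :
    propEval v (A.iff B) ↔ (propEval v A ↔ propEval v B) := by
  simp only [Formula.iff]; grind

namespace Provable

variable {X : Set Formula} {A B C D E : Formula}

/-- With `C = □ⁿ⊥`, equivalence modulo `□ⁿ⊥` of arguments gives equivalence modulo `□ⁿ⁺¹⊥` of modal
formulas. With `C = ¬⊥` this is plain congruence. -/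
theorem box_congr (h : Provable X (C.imp (A.iff B))) :
    Provable X (C.box.imp (A.box.iff B.box)) := by
  have h₁ : Provable X (C.imp (A.imp B)) := h.of_taut fun v => by grind
  have h₂ : Provable X (C.imp (B.imp A)) := h.of_taut fun v => by grind
  exact h₁.box_mono₂.of_taut₂ h₂.box_mono₂ fun v => by grind

theorem rhd_of_rhd {A' B' : Formula} (hA : Provable X (C.imp (A'.imp A)))
    (hB : Provable X (C.imp (B.imp B'))) :
    Provable X (C.box.imp ((A.rhd B).imp (A'.rhd B'))) := by
  have h : Provable X (C.box.imp ((A.rhd B).imp (A'.rhd B))) :=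
    hA.box_mono.of_taut₃ (J2 A' A B) (J1 A' A) fun v => by grind
  exact hB.box_mono.of_taut₄ (J2 A' B B') (J1 B B') h fun v => by grind

theorem rhd_congr {A' B' : Formula} (hA : Provable X (C.imp (A.iff A')))
    (hB : Provable X (C.imp (B.iff B'))) :
    Provable X (C.box.imp ((A.rhd B).iff (A'.rhd B'))) := by
  have h₁ : Provable X (C.imp (A.imp A')) := hA.of_taut fun v => by grind
  have h₂ : Provable X (C.imp (A'.imp A)) := hA.of_taut fun v => by grind
  have h₃ : Provable X (C.imp (B.imp B')) := hB.of_taut fun v => by grind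
  have h₄ : Provable X (C.imp (B'.imp B)) := hB.of_taut fun v => by grind
  exact (rhd_of_rhd h₂ h₃).of_taut₂ (rhd_of_rhd h₁ h₄) fun v => by grind

theorem imp_congr {A' B' : Formula} (hA : Provable X (C.imp (A.iff A')))
    (hB : Provable X (C.imp (B.iff B'))) :
    Provable X (C.imp ((A.imp B).iff (A'.imp B'))) :=
  hA.of_taut₂ hB fun v => by grind

theorem of_mono {Y : Set Formula} (h : X ⊆ Y) (hA : Provable X A) : Provable Y A := by
  induction hA with
  | taut h => exact .taut h
  | ax hF => exact .ax (h hF)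
  | mp _ _ ih₁ ih₂ => exact ih₁.mp ih₂
  | nec _ ih => exact ih.nec
  | L1 A B => exact .L1 A B
  | L2 A => exact .L2 A
  | L3 A => exact .L3 A
  | J1 A B => exact .J1 A B
  | J2 A B C => exact .J2 A B C
  | J3 A B C => exact .J3 A B C
  | J4 A B => exact .J4 A B
  | J5 A => exact .J5 A

end Provable

/-- The formulas with code at most `a`, together with their negations. -/
def adequate (a : ℕ) : List Formula :=
  (List.range (a + 1)).map ofNat ++ (List.range (a + 1)).map fun c => (ofNat c).neg

theorem mem_adequate {a : ℕ} {A : Formula} (h : toNat A ≤ a) : A ∈ adequate a :=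
  List.mem_append_left _ (List.mem_map.2 ⟨toNat A, by simp; omega, ofNat_toNat A⟩)

theorem neg_mem_adequate {a : ℕ} {A : Formula} (h : toNat A ≤ a) : A.neg ∈ adequate a :=
  List.mem_append_right _ (List.mem_map.2 ⟨toNat A, by simp; omega, by rw [ofNat_toNat]⟩)

theorem length_adequate (a : ℕ) : (adequate a).length = 2 * a + 2 := by
  simp [adequate, two_mul]; omega

/-- Subformulas have smaller codes, so the list covers them all. The `▷` case uses the listed
formulas themselves, the `□` case their negations; `a < k` ensures that no variable of `A` is
erased. -/
theorem provable_rel_iff {X : Set Formula} {a k : ℕ} (hk : a < k) {A : Formula}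
    (hA : toNat A ≤ a) :
    Provable X ((rel k (disj ((adequate a).map last)) A).iff A) := by
  induction A with
  | var i =>
    have : i < k := by simp only [Formula.toNat] at hA; omega
    simp only [rel, if_pos this]
    exact .taut fun v => by grind
  | bot => exact .taut fun v => by simp only [rel]; grind
  | imp A B ihA ihB =>
    simp only [Formula.toNat] at hA
    have h₁ := Nat.left_le_pair (toNat A) (toNat B)
    have h₂ := Nat.right_le_pair (toNat A) (toNat B)
    exact (ihA (by omega)).of_taut₂ (ihB (by omega)) fun v => by simp only [rel]; grind
  | box A ih =>
    simp only [Formula.toNat] at hA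
    have h := ih (by omega)
    have h₁ := provable_box_of_box_last (X := X) (neg_mem_adequate (a := a) (A := A) (by omega))
    simp only [rel]
    generalize disj ((adequate a).map last) = δ at *
    have h₂ : Provable X ((δ.imp (rel k δ A)).box.imp (δ.imp A).box) :=
      .box_mono (h.of_taut fun v => by grind)
    have h₃ : Provable X (A.box.imp (δ.imp (rel k δ A)).box) :=
      .box_mono (h.of_taut fun v => by grind)
    exact h₁.of_taut₃ h₂ h₃ fun v => by grind
  | rhd A B ihA ihB =>
    simp only [Formula.toNat] at hA
    have h₁ := Nat.left_le_pair (toNat A) (toNat B)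
    have h₂ := Nat.right_le_pair (toNat A) (toNat B)
    have hA' := ihA (by omega)
    have hB' := ihB (by omega)
    have h₃ := provable_rhd_and_last (X := X) (mem_adequate (a := a) (A := A) (by omega))
    have h₄ := provable_rhd_and_last (X := X) (mem_adequate (a := a) (A := B) (by omega))
    simp only [rel]
    generalize disj ((adequate a).map last) = δ at *
    have hA'' : Provable X ((bot.neg).imp ((A.and δ).iff ((rel k δ A).and δ))) :=
      hA'.of_taut fun v => by grind
    have hB'' : Provable X ((bot.neg).imp ((B.and δ).iff ((rel k δ B).and δ))) :=
      hB'.of_taut fun v => by grind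
    have h₅ := (hA''.rhd_congr hB'').mp (.nec (.taut fun v => id))
    have h₆ : Provable X ((A.rhd B).imp ((A.and δ).rhd (B.and δ))) :=
      (Provable.rhd_mono (A := A) (B := B) (A' := A.and δ)
        (.taut fun v => by grind) (.taut fun v => id)).of_taut₃
        h₄ (.J2 (A.and δ) B (B.and δ)) fun v => by grind
    have h₇ : Provable X (((A.and δ).rhd (B.and δ)).imp (A.rhd B)) :=
      (Provable.rhd_mono (A := A.and δ) (B := B.and δ) (B' := B)
        (.taut fun v => id) (.taut fun v => by grind)).of_taut₃
        h₃ (.J2 A (A.and δ) B) fun v => by grind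
    exact h₅.of_taut₃ h₆ h₇ fun v => by grind

/-- A formula is a theorem as soon as it is a theorem under a bound on the depth. -/
theorem provable_bounded_iff {X : Set Formula} {A : Formula}
    (hX : ∀ (k : ℕ) (δ : Formula), ∀ F ∈ X, Provable X (rel k δ F)) :
    Provable (bounded X (2 * toNat A + 3) (toNat A + 1)) A ↔ Provable X A := by
  refine ⟨fun h => ?_, fun h => h.of_mono Set.subset_union_left⟩
  have h₁ := provable_rel_boxIter (X := X) (toNat A + 1) (adequate (toNat A))
  rw [length_adequate] at h₁
  exact (provable_rel (hX _ _) h₁ h).of_taut₂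
    (provable_rel_iff (A := A) (Nat.lt_succ_self _) le_rfl) fun v => by grind

/-! ### Finitely many formulas at bounded depth. -/

/-- A bound for the number of formulas in `k` variables up to equivalence modulo `□ⁿ⊥`. -/
def classBound (k : ℕ) : ℕ → ℕ
  | 0 => 1
  | n + 1 => 2 ^ 2 ^ (k + (classBound k n + classBound k n * classBound k n))

/-- Truth values of the atoms of a formula, read off from a set of atoms up to equivalence. -/
def atomVal {k N : ℕ} (q : Formula → Fin N) (s : Set (Fin k ⊕ Fin N ⊕ Fin N × Fin N)) :
    Formula → Prop
  | var i => ∃ h : i < k, Sum.inl ⟨i, h⟩ ∈ s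
  | box A => Sum.inr (Sum.inl (q A)) ∈ s
  | rhd A B => Sum.inr (Sum.inr (q A, q B)) ∈ s
  | _ => False

/-- Replace the arguments of outermost modalities by representatives, and the variables with index
at least `k` by `⊥`. -/
def flatten (k : ℕ) (r : Formula → Formula) : Formula → Formula
  | var i => if i < k then var i else bot
  | bot => bot
  | imp A B => (flatten k r A).imp (flatten k r B)
  | box A => (r A).box
  | rhd A B => (r A).rhd (r B)

/-- Over finitely many variables, there are finitely many formulas up to equivalence modulo
`□ⁿ⊥`. -/
theorem exists_classes {Y : Set Formula} {k : ℕ} (hY : ∀ i, k ≤ i → Provable Y (var i).neg)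
    (n : ℕ) : ∃ q : Formula → Fin (classBound k n), ∀ A B : Formula, q A = q B →
      Provable Y ((boxIter n bot).imp (A.iff B)) := by
  induction n with
  | zero =>
    -- Modulo `□⁰⊥ = ⊥` all formulas are equivalent.
    exact ⟨fun _ => ⟨0, Nat.one_pos⟩, fun A B _ => .taut fun v => by simp only [boxIter]; grind⟩
  | succ n ih =>
    obtain ⟨q, hq⟩ := ih
    have : Nonempty Formula := ⟨bot⟩
    let r : Formula → Formula := fun A => Function.invFun q (q A)
    have hr : ∀ A : Formula, Provable Y ((boxIter n bot).imp (A.iff (r A))) := fun A =>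
      hq _ _ (Function.invFun_eq ⟨A, rfl⟩).symm
    have hflat : ∀ A : Formula, Provable Y ((boxIter (n + 1) bot).imp (A.iff (flatten k r A))) := by
      intro A
      induction A with
      | var i =>
        by_cases hi : i < k
        · simp only [flatten, if_pos hi]
          exact .taut fun v => by grind
        · simp only [flatten, if_neg hi]
          exact (hY i (not_lt.1 hi)).of_taut fun v => by grind
      | bot => exact .taut fun v => by simp only [flatten]; grind
      | imp A B ihA ihB => exact ihA.imp_congr ihB
      | box A => exact (hr A).box_congr
      | rhd A B => exact (hr A).rhd_congr (hr B)
    -- After flattening, the atoms are `k` variables, `N` boxes and `N * N` formulas `▷`, where `N =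
    -- classBound k n`. A formula is classified by its truth function, that is, by a set of sets of
    -- atoms.
    let e : Set (Set (Fin k ⊕ Fin (classBound k n) ⊕ Fin (classBound k n) × Fin (classBound k n))) ≃
        Fin (classBound k (n + 1)) := by
      classical
      exact Fintype.equivFinOfCardEq (by simp [classBound])
    refine ⟨fun A => e {s | propEval (atomVal q s) A}, fun A B hAB => ?_⟩
    have hAB : ∀ s, propEval (atomVal q s) A ↔ propEval (atomVal q s) B :=
      Set.ext_iff.1 (e.injective hAB)
    refine (hflat A).of_taut₃ (hflat B) (.taut (A := (flatten k r A).iff (flatten k r B)) ?_)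
      fun v => by grind
    intro v
    let s : Set (Fin k ⊕ Fin (classBound k n) ⊕ Fin (classBound k n) × Fin (classBound k n)) :=
      fun x => match x with
      | .inl i => v (var i)
      | .inr (.inl x) => v (box (Function.invFun q x))
      | .inr (.inr (x, y)) => v (rhd (Function.invFun q x) (Function.invFun q y))
    have hs : ∀ C, propEval v (flatten k r C) ↔ propEval (atomVal q s) C := by
      intro C
      induction C with
      | var i =>
        by_cases hi : i < k
        · simp only [flatten, propEval, atomVal, hi, exists_true_left]
          exact Iff.rfl
        · simp [flatten, hi, propEval, atomVal]
      | bot => exact Iff.rfl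
      | imp A B ihA ihB => exact imp_congr ihA ihB
      | box A => exact Iff.rfl
      | rhd A B => exact Iff.rfl
    rw [propEval_iff, hs, hs, hAB]

/-! ### Algebraic semantics and soundness. -/

/-- A set with operations for the connectives. -/
structure Alg (α : Type*) where
  /-- the value of `⊥` -/
  bot : α
  /-- the interpretation of `→` -/
  imp : α → α → α
  /-- the interpretation of `□` -/
  box : α → α
  /-- the interpretation of `▷` -/
  rhd : α → α → α

namespace Alg

variable {α : Type*} (M : Alg α)

/-- The designated value. -/
def top : α := M.imp M.bot M.bot

/-- The value of a formula. -/
def eval (v : ℕ → α) : Formula → α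
  | .var i => v i
  | .bot => M.bot
  | .imp A B => M.imp (eval v A) (eval v B)
  | .box A => M.box (eval v A)
  | .rhd A B => M.rhd (eval v A) (eval v B)

end Alg

/-- The sequence `x, y, z, z, …`. -/
def triple {α : Type*} (x y z : α) : ℕ → α
  | 0 => x
  | 1 => y
  | _ => z

/-- Simultaneous substitution. -/
def Formula.subst (s : ℕ → Formula) : Formula → Formula
  | var i => s i
  | bot => bot
  | imp A B => (subst s A).imp (subst s B)
  | box A => (subst s A).box
  | rhd A B => (subst s A).rhd (subst s B)

theorem Formula.subst_var (A : Formula) : A.subst var = A := by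
  induction A <;> simp_all [Formula.subst]

theorem Alg.eval_subst {α : Type*} (M : Alg α) (v : ℕ → α) (A B C F : Formula) :
    M.eval v (F.subst (triple A B C)) =
      M.eval (triple (M.eval v A) (M.eval v B) (M.eval v C)) F := by
  induction F with
  | var i => rcases i with _ | _ | i <;> rfl
  | _ => simp_all [Formula.subst, Alg.eval]

/-- The axioms of **IL**, with a Hilbert-style axiomatisation of propositional logic, as formulas
in the variables `p₀, p₁, p₂`. -/
def schemata : List Formula :=
  let A := var 0
  let B := var 1
  let C := var 2
  [A.imp (B.imp A),
    (A.imp (B.imp C)).imp ((A.imp B).imp (A.imp C)),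
    A.neg.neg.imp A,
    (A.imp B).box.imp (A.box.imp B.box),
    A.box.imp A.box.box,
    (A.box.imp A).box.imp A.box,
    (A.imp B).box.imp (A.rhd B),
    ((A.rhd B).and (B.rhd C)).imp (A.rhd C),
    ((A.rhd C).and (B.rhd C)).imp ((A.or B).rhd C),
    (A.rhd B).imp (A.dia.imp B.dia),
    A.dia.rhd A]

/-- The substitution instances of `χ`, a formula in the variables `p₀, p₁, p₂`. -/
def instances (χ : Formula) : Set Formula :=
  {F | ∃ A B C : Formula, F = χ.subst (triple A B C)}

/-- The algebra validates the axioms and rules of the logic axiomatised by `χ` over **IL**. -/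
structure Alg.IsModel {α : Type*} (M : Alg α) (χ : Formula) : Prop where
  valid : ∀ F ∈ χ :: schemata, ∀ x y z, M.eval (triple x y z) F = M.top
  mp : ∀ y, M.imp M.top y = M.top → y = M.top
  nec : M.box M.top = M.top

namespace Alg

variable {α : Type*} {M : Alg α} {χ : Formula}

/-- A set of values that contains the designated one and is closed under modus ponens. -/
structure IsTheory (M : Alg α) (T : Set α) : Prop where
  top_mem : M.top ∈ T
  mp : ∀ {x y}, M.imp x y ∈ T → x ∈ T → y ∈ T

/-- The consequences of a theory and an additional hypothesis. -/
def adjoin (M : Alg α) (T : Set α) (x : α) : Set α := {y | M.imp x y ∈ T}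

namespace IsModel

variable (hM : M.IsModel χ) {T : Set α}
include hM

theorem imp_imp (x y : α) : M.imp x (M.imp y x) = M.top :=
  hM.valid ((var 0).imp ((var 1).imp (var 0))) (by simp [schemata]) x y y

theorem imp_distrib (x y z : α) :
    M.imp (M.imp x (M.imp y z)) (M.imp (M.imp x y) (M.imp x z)) = M.top :=
  hM.valid (((var 0).imp ((var 1).imp (var 2))).imp
    (((var 0).imp (var 1)).imp ((var 0).imp (var 2)))) (by simp [schemata]) x y z

theorem neg_neg_imp (x : α) : M.imp (M.imp (M.imp x M.bot) M.bot) x = M.top :=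
  hM.valid ((var 0).neg.neg.imp (var 0)) (by simp [schemata]) x x x

theorem isTheory_top : M.IsTheory {M.top} :=
  ⟨rfl, by rintro x y hxy rfl; exact hM.mp y hxy⟩

theorem imp_mem (hT : M.IsTheory T) {x : α} (y : α) (hx : x ∈ T) : M.imp y x ∈ T :=
  hT.mp (by rw [hM.imp_imp]; exact hT.top_mem) hx

/-- The deduction theorem, semantically. -/
theorem isTheory_adjoin (hT : M.IsTheory T) (x : α) : M.IsTheory (M.adjoin T x) :=
  ⟨hM.imp_mem hT x hT.top_mem,
    fun h₁ h₂ => hT.mp (hT.mp (by rw [hM.imp_distrib]; exact hT.top_mem) h₁) h₂⟩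

theorem mem_adjoin_self (hT : M.IsTheory T) (x : α) : x ∈ M.adjoin T x :=
  hT.mp (x := M.imp x (M.imp x x))
    (hT.mp (x := M.imp x (M.imp (M.imp x x) x)) (by rw [hM.imp_distrib]; exact hT.top_mem)
      (by rw [hM.imp_imp]; exact hT.top_mem))
    (by rw [hM.imp_imp]; exact hT.top_mem)

theorem mem_of_bot_mem (hT : M.IsTheory T) (h : M.bot ∈ T) (x : α) : x ∈ T :=
  hT.mp (by rw [hM.neg_neg_imp]; exact hT.top_mem) (hM.imp_mem hT (M.imp x M.bot) h)

/-- Tautologies are valid in a finite model. -/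
theorem eval_eq_top_of_isTautology [Finite α] {A : Formula} (hA : A.IsTautology) (v : ℕ → α) :
    M.eval v A = M.top := by
  by_contra ha
  set a := M.eval v A
  obtain ⟨T, hT, hmax⟩ := (Set.toFinite {T : Set α | M.IsTheory T ∧ a ∉ T}).exists_maximal
    ⟨{M.top}, hM.isTheory_top, ha⟩
  obtain ⟨hT, haT⟩ := hT
  have hadj : ∀ x, x ∉ T → M.imp x a ∈ T := by
    intro x hx
    by_contra h
    exact hx (hmax ⟨hM.isTheory_adjoin hT x, h⟩ (fun y hy => hM.imp_mem hT x hy)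
      (hM.mem_adjoin_self hT x))
  -- Otherwise `T` contains both `x → a` and `¬x → a`. Adjoining `¬a` then yields `¬x`, hence `a`,
  -- hence `⊥`, so `¬¬a` and therefore `a` lie in `T`.
  have hneg : ∀ x, x ∉ T → M.imp x M.bot ∈ T := by
    intro x hx
    by_contra hn
    have h₁ := hadj x hx
    have h₂ := hadj _ hn
    refine haT (hT.mp (x := M.imp (M.imp a M.bot) M.bot)
      (by rw [hM.neg_neg_imp]; exact hT.top_mem) ?_)
    have hT' := hM.isTheory_adjoin hT (M.imp a M.bot)
    have hna := hM.mem_adjoin_self hT (M.imp a M.bot)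
    have hT'' := hM.isTheory_adjoin hT' x
    have hnx : M.imp x M.bot ∈ M.adjoin T (M.imp a M.bot) :=
      hT''.mp (hM.imp_mem hT' x hna)
        (hT''.mp (hM.imp_mem hT' x (hM.imp_mem hT _ h₁)) (hM.mem_adjoin_self hT' x))
    exact hT'.mp hna (hT'.mp (hM.imp_mem hT _ h₂) hnx)
  have hbot : M.bot ∉ T := fun h => haT (hM.mem_of_bot_mem hT h a)
  have himp : ∀ x y, M.imp x y ∈ T ↔ (x ∈ T → y ∈ T) := by
    refine fun x y => ⟨hT.mp, fun h => ?_⟩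
    by_cases hx : x ∈ T
    · exact hM.imp_mem hT x (h hx)
    · exact hM.mem_of_bot_mem (hM.isTheory_adjoin hT x) (hneg x hx) y
  have key : ∀ F, propEval (fun G => M.eval v G ∈ T) F ↔ M.eval v F ∈ T := by
    intro F
    induction F with
    | bot => exact iff_of_false id hbot
    | imp A B ihA ihB => rw [propEval, Alg.eval, himp, ihA, ihB]
    | _ => exact Iff.rfl
  exact haT ((key A).1 (hA _))

/-- Theorems are valid in a finite model. -/
theorem eval_eq_top [Finite α] {A : Formula} (hA : Provable (instances χ) A) (v : ℕ → α) :
    M.eval v A = M.top := by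
  have key : ∀ F ∈ χ :: schemata, ∀ A B C, M.eval v (F.subst (triple A B C)) = M.top :=
    fun F hF A B C => by rw [Alg.eval_subst]; exact hM.valid F hF _ _ _
  have base : ∀ F ∈ schemata, ∀ A B C, M.eval v (F.subst (triple A B C)) = M.top :=
    fun F hF => key F (List.mem_cons_of_mem _ hF)
  simp only [schemata, List.forall_mem_cons] at base
  obtain ⟨-, -, -, h1, h2, h3, h4, h5, h6, h7, h8, -⟩ := base
  induction hA with
  | taut h => exact hM.eval_eq_top_of_isTautology h v
  | L1 A B => exact h1 A B .bot
  | L2 A => exact h2 A .bot .bot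
  | L3 A => exact h3 A .bot .bot
  | J1 A B => exact h4 A B .bot
  | J2 A B C => exact h5 A B C
  | J3 A B C => exact h6 A B C
  | J4 A B => exact h7 A B .bot
  | J5 A => exact h8 A .bot .bot
  | ax h =>
    obtain ⟨A, B, C, rfl⟩ := h
    exact key χ (by simp) A B C
  | mp _ _ ih₁ ih₂ =>
    rw [Alg.eval, ih₂] at ih₁
    exact hM.mp _ ih₁
  | nec _ ih => rw [Alg.eval, ih, hM.nec]

end IsModel

end Alg

/-! ### The finite Lindenbaum algebra. -/

theorem provable_subst_of_mem_schemata {Y : Set Formula} :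
    ∀ F ∈ schemata, ∀ A B C, Provable Y (F.subst (triple A B C)) := by
  simp only [schemata, List.forall_mem_cons]
  refine ⟨fun A B C => ?_, fun A B C => ?_, fun A B C => ?_, fun A B C => .L1 A B,
    fun A B C => .L2 A, fun A B C => .L3 A, fun A B C => .J1 A B, fun A B C => .J2 A B C,
    fun A B C => .J3 A B C, fun A B C => .J4 A B, fun A B C => .J5 A, by simp⟩
  all_goals
    refine .taut fun v => ?_
    simp only [Formula.subst, triple, neg, propEval]
    tauto

theorem provable_iff_top {Y : Set Formula} {A : Formula} :
    Provable Y (A.iff (bot.imp bot)) ↔ Provable Y A :=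
  ⟨fun h => h.of_taut fun v => by grind, fun h => h.of_taut fun v => by grind⟩

/-- If there are finitely many formulas up to provable equivalence, then unprovable formulas are
refuted in the finite algebra of their classes. -/
theorem exists_model {Y : Set Formula} {χ : Formula} {N : ℕ} (hχ : instances χ ⊆ Y)
    (q : Formula → Fin N) (hq : ∀ A B : Formula, q A = q B → Provable Y (A.iff B)) {A : Formula}
    (hA : ¬ Provable Y A) :
    ∃ m ≤ N, ∃ M : Alg (Fin m), M.IsModel χ ∧ ∃ v, M.eval v A ≠ M.top := by
  let S : Setoid Formula :=
    ⟨fun A B => Provable Y (A.iff B), fun A => .taut fun v => by grind,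
      fun h => h.of_taut fun v => by grind, fun h₁ h₂ => h₁.of_taut₂ h₂ fun v => by grind⟩
  have hinj : Function.Injective fun c : Quotient S => q c.out := fun c d h => by
    rw [← c.out_eq, ← d.out_eq]
    exact Quotient.sound (hq _ _ h)
  have : Finite (Quotient S) := Finite.of_injective _ hinj
  have hcard : Nat.card (Quotient S) ≤ N := by
    simpa using Nat.card_le_card_of_injective _ hinj
  let e : Quotient S ≃ Fin (Nat.card (Quotient S)) := Finite.equivFin _
  let j : Formula → Fin (Nat.card (Quotient S)) := fun A => e ⟦A⟧
  have hj : ∀ A B, j A = j B ↔ Provable Y (A.iff B) := fun A B =>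
    e.injective.eq_iff.trans Quotient.eq
  let r : Fin (Nat.card (Quotient S)) → Formula := fun x => (e.symm x).out
  have hjr : ∀ x, j (r x) = x := fun x => by simp [j, r]
  have hr : ∀ A, Provable Y ((r (j A)).iff A) := fun A => (hj _ _).1 (hjr _)
  have hr' : ∀ A, Provable Y (bot.neg.imp ((r (j A)).iff A)) := fun A =>
    (hr A).of_taut fun v h _ => h
  have hnb : Provable Y bot.neg := .taut fun v => id
  let M : Alg (Fin (Nat.card (Quotient S))) :=
    { bot := j bot
      imp := fun x y => j ((r x).imp (r y))
      box := fun x => j (r x).box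
      rhd := fun x y => j ((r x).rhd (r y)) }
  have himp : ∀ A B, M.imp (j A) (j B) = j (A.imp B) := fun A B =>
    (hj _ _).2 (((hr' A).imp_congr (hr' B)).mp hnb)
  have hbox : ∀ A, M.box (j A) = j A.box := fun A => (hj _ _).2 ((hr' A).box_congr.mp hnb.nec)
  have hrhd : ∀ A B, M.rhd (j A) (j B) = j (A.rhd B) := fun A B =>
    (hj _ _).2 (((hr' A).rhd_congr (hr' B)).mp hnb.nec)
  -- Truth lemma: evaluating at the classes of `s i` gives the class of the substitution instance.
  have heval : ∀ (v : ℕ → Fin (Nat.card (Quotient S))) (s : ℕ → Formula),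
      (∀ i, v i = j (s i)) → ∀ F, M.eval v F = j (F.subst s) := by
    intro v s hvs F
    induction F with
    | var i => exact hvs i
    | bot => rfl
    | imp A B ihA ihB => rw [Alg.eval, ihA, ihB, himp]; rfl
    | box A ih => rw [Alg.eval, ih, hbox]; rfl
    | rhd A B ihA ihB => rw [Alg.eval, ihA, ihB, hrhd]; rfl
  have htop' : M.top = j (bot.imp bot) := himp _ _
  have htop_iff : ∀ A, j A = M.top ↔ Provable Y A := fun A => by
    rw [htop', hj, provable_iff_top]
  refine ⟨_, hcard, M, ⟨?_, ?_, ?_⟩, fun i => j (var i), ?_⟩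
  · intro F hF x y z
    rw [heval _ (triple (r x) (r y) (r z)), htop_iff]
    · rcases List.mem_cons.1 hF with rfl | hF
      · exact .ax (hχ ⟨_, _, _, rfl⟩)
      · exact provable_subst_of_mem_schemata F hF _ _ _
    · rintro (_ | _ | i) <;> exact (hjr _).symm
  · intro y hy
    rw [← hjr y, htop', himp, ← htop', htop_iff] at hy
    rw [← hjr y, htop_iff]
    exact hy.mp hnb
  · rw [htop', hbox, ← htop', htop_iff]
    exact hnb.nec
  · rw [heval _ var fun _ => rfl, Formula.subst_var, Ne, htop_iff]
    exact hA

/-- The size of algebras that suffices to refute non-theorems with Gödel number `a`. -/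
def modelBound (a : ℕ) : ℕ := classBound (a + 1) (2 * a + 3)

/-- Theoremhood is validity in all models of bounded size. -/
theorem provable_iff_forall_model {χ A : Formula}
    (hχ : ∀ (k : ℕ) (δ : Formula), ∀ F ∈ instances χ, Provable (instances χ) (rel k δ F)) :
    Provable (instances χ) A ↔ ∀ m < modelBound A.toNat + 1, ∀ M : Alg (Fin m), M.IsModel χ →
      ∀ v, M.eval v A = M.top := by
  refine ⟨fun h m _ M hM v => hM.eval_eq_top h v, fun h => ?_⟩
  by_contra hA
  rw [← provable_bounded_iff hχ] at hA
  set Y := bounded (instances χ) (2 * A.toNat + 3) (A.toNat + 1) with hY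
  have h₁ : ∀ i, A.toNat + 1 ≤ i → Provable Y (var i).neg :=
    fun i hi => .ax (.inr (.inr ⟨i, hi, rfl⟩))
  have h₂ : Provable Y (boxIter (2 * A.toNat + 3) bot) := .ax (.inr (.inl rfl))
  obtain ⟨q, hq⟩ := exists_classes h₁ (2 * A.toNat + 3)
  obtain ⟨m, hm, M, hM, v, hv⟩ := exists_model (χ := χ) Set.subset_union_left q
    (fun B C h => (hq B C h).mp h₂) hA
  exact hv (h m (Nat.lt_succ_of_le hm) M hM v)

/-! ### Coding algebras and evaluations by digits of numbers. -/

/-- The `i`-th digit of `t` in base `m`. -/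
def digit (m t i : ℕ) : ℕ := t / m ^ i % m

theorem digit_lt {m : ℕ} (hm : 0 < m) (t i : ℕ) : digit m t i < m := Nat.mod_lt _ hm

theorem exists_digit_eq {m : ℕ} (hm : 0 < m) (n : ℕ) :
    ∀ f : ℕ → ℕ, (∀ i, f i < m) → ∃ t < m ^ n, ∀ i < n, digit m t i = f i := by
  induction n with
  | zero => exact fun f _ => ⟨0, by simp, by simp⟩
  | succ n ih =>
    intro f hf
    obtain ⟨t, ht, h⟩ := ih (fun i => f (i + 1)) fun i => hf _
    refine ⟨f 0 + m * t, ?_, ?_⟩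
    · calc f 0 + m * t < m + m * t := Nat.add_lt_add_right (hf 0) _
        _ = m * (t + 1) := by ring
        _ ≤ m * m ^ n := Nat.mul_le_mul_left _ ht
        _ = m ^ (n + 1) := by ring
    · rintro (_ | i) hi
      · simp [digit, Nat.mod_eq_of_lt (hf 0)]
      · rw [← h i (by omega), digit, digit, pow_succ', ← Nat.div_div_eq_div_mul,
          Nat.add_mul_div_left _ _ hm, Nat.div_eq_of_lt (hf 0), zero_add]

/-- The algebra on numbers below `m` coded by the number `t`. -/
def codeAlg (m t : ℕ) : Alg ℕ where
  -- The digit positions follow the Gödel numbering of formulas, which keeps the tables of the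
  -- operations disjoint.
  bot := digit m t 0
  imp x y := digit m t (4 * Nat.pair x y + 3)
  box x := digit m t (4 * x + 2)
  rhd x y := digit m t (4 * Nat.pair x y + 4)

/-- The number `t` codes the algebra `M`. -/
structure Codes {m : ℕ} (t : ℕ) (M : Alg (Fin m)) : Prop where
  bot : (codeAlg m t).bot = M.bot
  imp : ∀ x y : Fin m, (codeAlg m t).imp x y = M.imp x y
  box : ∀ x : Fin m, (codeAlg m t).box x = M.box x
  rhd : ∀ x y : Fin m, (codeAlg m t).rhd x y = M.rhd x y

theorem exists_codes_alg {m : ℕ} (hm : 0 < m) (t : ℕ) : ∃ M : Alg (Fin m), Codes t M :=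
  ⟨⟨⟨_, digit_lt hm t 0⟩, fun x y => ⟨_, digit_lt hm t (4 * Nat.pair x y + 3)⟩,
    fun x => ⟨_, digit_lt hm t (4 * x + 2)⟩,
    fun x y => ⟨_, digit_lt hm t (4 * Nat.pair x y + 4)⟩⟩,
    rfl, fun _ _ => rfl, fun _ => rfl, fun _ _ => rfl⟩

/-- Pairs of elements have code below `m ^ 2`, so the largest position needed is `4 * (m ^ 2 - 1) +
4 = 4 * m ^ 2`. -/
theorem exists_code {m : ℕ} (M : Alg (Fin m)) : ∃ t < m ^ (4 * m ^ 2 + 1), Codes t M := by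
  have hm : 0 < m := M.bot.pos
  have hmod : ∀ x, x % m < m := fun x => Nat.mod_lt _ hm
  let f : ℕ → ℕ := fun c => match c with
    | 0 => M.bot
    | c + 1 => match c % 4 with
      | 1 => M.box ⟨_, hmod (c / 4)⟩
      | 2 => M.imp ⟨_, hmod (c / 4).unpair.1⟩ ⟨_, hmod (c / 4).unpair.2⟩
      | _ => M.rhd ⟨_, hmod (c / 4).unpair.1⟩ ⟨_, hmod (c / 4).unpair.2⟩
  have hf : ∀ i, f i < m := by
    rintro (_ | c)
    · exact M.bot.2
    · simp only [f]
      split <;> exact Fin.is_lt _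
  obtain ⟨t, ht, h⟩ := exists_digit_eq hm (4 * m ^ 2 + 1) f hf
  have hpair : ∀ x y : Fin m, Nat.pair x y < m ^ 2 := fun x y =>
    (Nat.pair_lt_max_add_one_sq _ _).trans_le (Nat.pow_le_pow_left (by omega) 2)
  have hx : ∀ x : Fin m, (⟨x % m, hmod x⟩ : Fin m) = x :=
    fun x => Fin.ext (Nat.mod_eq_of_lt x.2)
  refine ⟨t, ht, h 0 (by omega), fun x y => ?_, fun x => ?_, fun x y => ?_⟩
  · have h1 : (4 * Nat.pair x y + 2) % 4 = 2 := by omega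
    have h2 : (4 * Nat.pair x y + 2) / 4 = Nat.pair x y := by omega
    refine (h _ (by have := hpair x y; omega)).trans ?_
    simp only [f, h1, h2, Nat.unpair_pair, hx]
  · have h1 : (4 * (x : ℕ) + 1) % 4 = 1 := by omega
    have h2 : (4 * (x : ℕ) + 1) / 4 = x := by omega
    refine (h _ (by have := hpair x x; have := Nat.left_le_pair x x; omega)).trans ?_
    simp only [f, h1, h2, hx]
  · have h1 : (4 * Nat.pair x y + 3) % 4 = 3 := by omega
    have h2 : (4 * Nat.pair x y + 3) / 4 = Nat.pair x y := by omega
    refine (h _ (by have := hpair x y; omega)).trans ?_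
    simp only [f, h1, h2, Nat.unpair_pair, hx]

/-- The number `t` codes a model with `m` elements. -/
def CodesModel (χ : Formula) (m t : ℕ) : Prop :=
  (∀ F ∈ χ :: schemata, ∀ x < m, ∀ y < m, ∀ z < m,
    (codeAlg m t).eval (triple x y z) F = (codeAlg m t).top) ∧
  (∀ y < m, (codeAlg m t).imp (codeAlg m t).top y = (codeAlg m t).top →
    y = (codeAlg m t).top) ∧
  (codeAlg m t).box (codeAlg m t).top = (codeAlg m t).top

/-- The number `e` codes the values of the formulas with Gödel number at most `a`. -/
def CodesEval (m t e a : ℕ) : Prop :=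
  -- Positions `c + 1` with `c % 4 = 0` belong to variables and stay unconstrained, so `e` also
  -- codes the valuation.
  digit m e 0 = (codeAlg m t).bot ∧ ∀ c < a,
    (c % 4 = 1 → digit m e (c + 1) = (codeAlg m t).box (digit m e (c / 4))) ∧
    (c % 4 = 2 → digit m e (c + 1) =
      (codeAlg m t).imp (digit m e (c / 4).unpair.1) (digit m e (c / 4).unpair.2)) ∧
    (c % 4 = 3 → digit m e (c + 1) =
      (codeAlg m t).rhd (digit m e (c / 4).unpair.1) (digit m e (c / 4).unpair.2))

namespace Codes

variable {m t : ℕ} {M : Alg (Fin m)} (h : Codes t M)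
include h

theorem top : (codeAlg m t).top = M.top := by
  rw [Alg.top, h.bot, h.imp]; rfl

theorem eval (v : ℕ → Fin m) (F : Formula) :
    (codeAlg m t).eval (fun i => v i) F = M.eval v F := by
  induction F with
  | var i => rfl
  | bot => exact h.bot
  | imp A B ihA ihB => rw [Alg.eval, ihA, ihB, h.imp]; rfl
  | box A ih => rw [Alg.eval, ih, h.box]; rfl
  | rhd A B ihA ihB => rw [Alg.eval, ihA, ihB, h.rhd]; rfl

theorem codesModel_iff {χ : Formula} : CodesModel χ m t ↔ M.IsModel χ := by
  have h₁ : ∀ (F : Formula) (x y z : Fin m),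
      (codeAlg m t).eval (triple x y z) F = (codeAlg m t).top ↔
        M.eval (triple x y z) F = M.top := by
    intro F x y z
    have : (triple x y z : ℕ → ℕ) = fun i => ((triple x y z i : Fin m) : ℕ) := by
      funext i; rcases i with _ | _ | i <;> rfl
    rw [this, h.eval, h.top, Fin.val_inj]
  have h₂ : ∀ y : Fin m, (codeAlg m t).imp (codeAlg m t).top y = (codeAlg m t).top ↔
      M.imp M.top y = M.top := fun y => by rw [h.top, h.imp, Fin.val_inj]
  have h₃ : (codeAlg m t).box (codeAlg m t).top = (codeAlg m t).top ↔ M.box M.top = M.top := by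
    rw [h.top, h.box, Fin.val_inj]
  constructor
  · rintro ⟨hF, hmp, hnec⟩
    refine ⟨fun F hF' x y z => (h₁ F x y z).1 (hF F hF' x x.2 y y.2 z z.2), fun y hy => ?_,
      h₃.1 hnec⟩
    exact Fin.ext ((hmp y y.2 ((h₂ y).2 hy)).trans h.top)
  · intro hM
    refine ⟨fun F hF x hx y hy z hz => (h₁ F ⟨x, hx⟩ ⟨y, hy⟩ ⟨z, hz⟩).2 (hM.valid F hF _ _ _),
      fun y hy hyt => ?_, h₃.2 hM.nec⟩
    rw [h.top, ← hM.mp ⟨y, hy⟩ ((h₂ ⟨y, hy⟩).1 hyt)]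

theorem exists_codesEval (v : ℕ → Fin m) (a : ℕ) :
    ∃ e < m ^ (a + 1), CodesEval m t e a ∧ digit m e a = M.eval v (ofNat a) := by
  obtain ⟨e, he, hd⟩ := exists_digit_eq M.bot.pos (a + 1) (fun c => M.eval v (ofNat c))
    fun _ => Fin.is_lt _
  refine ⟨e, he, ⟨?_, fun c hc => ?_⟩, hd a (by omega)⟩
  · rw [hd 0 (by omega), h.bot, ofNat]; rfl
  · have hc4 : c / 4 < a + 1 := by omega
    have h₁ := (Nat.unpair_left_le (c / 4)).trans_lt hc4
    have h₂ := (Nat.unpair_right_le (c / 4)).trans_lt hc4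
    rw [hd _ (by omega), hd _ hc4, hd _ h₁, hd _ h₂, h.box, h.imp, h.rhd, ofNat]
    refine ⟨fun hr => ?_, fun hr => ?_, fun hr => ?_⟩ <;> simp only [hr] <;> rfl

theorem digit_eq_eval {e a : ℕ} (he : CodesEval m t e a) {v : ℕ → Fin m}
    (hv : ∀ i, digit m e (4 * i + 1) = v i) :
    ∀ A : Formula, A.toNat ≤ a → digit m e A.toNat = M.eval v A := by
  intro A
  induction A with
  | var i => exact fun _ => hv i
  | bot => exact fun _ => he.1.trans h.bot
  | box A ih =>
    intro hA
    simp only [Formula.toNat] at hA ⊢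
    have := (he.2 (4 * A.toNat + 1) (by omega)).1 (by omega)
    rw [show (4 * A.toNat + 1) / 4 = A.toNat by omega, ih (by omega), h.box] at this
    exact this
  | imp A B ihA ihB =>
    intro hA
    simp only [Formula.toNat] at hA ⊢
    have h₁ := Nat.left_le_pair A.toNat B.toNat
    have h₂ := Nat.right_le_pair A.toNat B.toNat
    have := (he.2 (4 * Nat.pair A.toNat B.toNat + 2) (by omega)).2.1 (by omega)
    rw [show (4 * Nat.pair A.toNat B.toNat + 2) / 4 = Nat.pair A.toNat B.toNat by omega,
      Nat.unpair_pair, ihA (by omega), ihB (by omega), h.imp] at this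
    exact this
  | rhd A B ihA ihB =>
    intro hA
    simp only [Formula.toNat] at hA ⊢
    have h₁ := Nat.left_le_pair A.toNat B.toNat
    have h₂ := Nat.right_le_pair A.toNat B.toNat
    have := (he.2 (4 * Nat.pair A.toNat B.toNat + 3) (by omega)).2.2 (by omega)
    rw [show (4 * Nat.pair A.toNat B.toNat + 3) / 4 = Nat.pair A.toNat B.toNat by omega,
      Nat.unpair_pair, ihA (by omega), ihB (by omega), h.rhd] at this
    exact this

end Codes

/-- The formula with Gödel number `a` is valid in all coded models of bounded size. -/
def BoundedValid (χ : Formula) (a : ℕ) : Prop :=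
  ∀ m < modelBound a + 1, ∀ t < m ^ (4 * m ^ 2 + 1), ∀ e < m ^ (a + 1),
    ¬ (CodesModel χ m t ∧ CodesEval m t e a) ∨ digit m e a = (codeAlg m t).top

theorem boundedValid_iff {χ A : Formula} :
    BoundedValid χ A.toNat ↔ ∀ m < modelBound A.toNat + 1, ∀ M : Alg (Fin m), M.IsModel χ →
      ∀ v, M.eval v A = M.top := by
  constructor
  · intro h m hm M hM v
    obtain ⟨t, ht, hc⟩ := exists_code M
    obtain ⟨e, he, hce, hd⟩ := hc.exists_codesEval v A.toNat
    have := (h m hm t ht e he).resolve_left (not_not.2 ⟨hc.codesModel_iff.2 hM, hce⟩)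
    rw [hd, hc.top, ofNat_toNat] at this
    exact Fin.ext this
  · intro h m hm t ht e he
    rw [or_iff_not_imp_left, not_not]
    rintro ⟨hM, hE⟩
    -- For `m = 0` the bound `m ^ (4 * m ^ 2 + 1)` is `0`, and no `t` lies below it.
    have hpos : 0 < m := by
      rcases Nat.eq_zero_or_pos m with rfl | hpos
      · simp at ht
      · exact hpos
    obtain ⟨M, hc⟩ := exists_codes_alg hpos t
    rw [hc.digit_eq_eval hE (v := fun i => ⟨_, digit_lt hpos e (4 * i + 1)⟩) (fun _ => rfl) A le_rfl,
      hc.top, h m hm M (hc.codesModel_iff.1 hM)]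

/-! ### Primitive recursiveness of bounded validity. -/

section Primrec

variable {α : Type*} [Primcodable α]

theorem primrecPred_forall_lt {p : α → ℕ → Prop} {f : α → ℕ} (hf : Primrec f)
    (hp : PrimrecPred fun x : α × ℕ => p x.1 x.2) : PrimrecPred fun a => ∀ x < f a, p a x :=
  ((PrimrecRel.forall_mem_list (R := fun x a => p a x)
    (hp.comp (Primrec.pair Primrec.snd Primrec.fst))).comp
      (Primrec.list_range.comp hf) Primrec.id).of_eq fun _ => by simp

theorem primrecPred_forall_mem {β : Type*} {p : β → α → Prop} (l : List β)
    (hp : ∀ b, PrimrecPred (p b)) : PrimrecPred fun a => ∀ b ∈ l, p b a := by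
  induction l with
  | nil => exact (Primrec.eq.comp (Primrec.const 0) (Primrec.const 0)).of_eq fun a => by simp
  | cons b l ih => exact ((hp b).and ih).of_eq fun a => by simp

theorem primrecPred_imp {p q : α → Prop} (hp : PrimrecPred p) (hq : PrimrecPred q) :
    PrimrecPred fun a : α => p a → q a :=
  (hp.not.or hq).of_eq fun _ => imp_iff_not_or.symm

variable {m t e x y : α → ℕ} (hm : Primrec m) (ht : Primrec t) (he : Primrec e) (hx : Primrec x)
  (hy : Primrec y)

include hm hx in
theorem primrec_pow : Primrec fun a => m a ^ x a :=
  (Primrec₂.unpaired'.1 Nat.Primrec.pow).comp hm hx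

include hm ht hx in
theorem primrec_digit : Primrec fun a => digit (m a) (t a) (x a) :=
  Primrec.nat_mod.comp (Primrec.nat_div.comp ht (primrec_pow hm hx)) hm

include hx in
theorem primrec_four_mul_add (n : ℕ) : Primrec fun a => 4 * x a + n :=
  Primrec.nat_add.comp (Primrec.nat_mul.comp (Primrec.const 4) hx) (Primrec.const n)

include hm ht in
theorem primrec_codeAlg_bot : Primrec fun a => (codeAlg (m a) (t a)).bot :=
  primrec_digit hm ht (Primrec.const 0)

include hm ht hx hy in
theorem primrec_codeAlg_imp : Primrec fun a => (codeAlg (m a) (t a)).imp (x a) (y a) :=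
  primrec_digit hm ht (primrec_four_mul_add (Primrec₂.natPair.comp hx hy) 3)

include hm ht hx in
theorem primrec_codeAlg_box : Primrec fun a => (codeAlg (m a) (t a)).box (x a) :=
  primrec_digit hm ht (primrec_four_mul_add hx 2)

include hm ht hx hy in
theorem primrec_codeAlg_rhd : Primrec fun a => (codeAlg (m a) (t a)).rhd (x a) (y a) :=
  primrec_digit hm ht (primrec_four_mul_add (Primrec₂.natPair.comp hx hy) 4)

include hm ht in
theorem primrec_codeAlg_top : Primrec fun a => (codeAlg (m a) (t a)).top :=
  primrec_codeAlg_imp hm ht (primrec_codeAlg_bot hm ht) (primrec_codeAlg_bot hm ht)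

include hm ht in
-- `F` is fixed, so the recursion on it is external. This suffices for checking the finitely many
-- axioms; the formula to be decided is handled by `CodesEval` instead.
theorem primrec_codeAlg_eval {v : α → ℕ → ℕ} (hv : ∀ i, Primrec fun a => v a i) (F : Formula) :
    Primrec fun a => (codeAlg (m a) (t a)).eval (v a) F := by
  induction F with
  | var i => exact hv i
  | bot => exact primrec_codeAlg_bot hm ht
  | imp A B ihA ihB => exact primrec_codeAlg_imp hm ht ihA ihB
  | box A ih => exact primrec_codeAlg_box hm ht ih
  | rhd A B ihA ihB => exact primrec_codeAlg_rhd hm ht ihA ihB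

include hm ht in
theorem primrecPred_codesModel (χ : Formula) :
    PrimrecPred fun a => CodesModel χ (m a) (t a) := by
  refine (primrecPred_forall_mem _ fun F => ?_).and (PrimrecPred.and ?_ ?_)
  · refine primrecPred_forall_lt hm (primrecPred_forall_lt (hm.comp .fst)
      (primrecPred_forall_lt (hm.comp (.comp .fst .fst)) ?_))
    have hp : Primrec fun a : ((α × ℕ) × ℕ) × ℕ => a.1.1.1 := .comp .fst (.comp .fst .fst)
    refine Primrec.eq.comp (primrec_codeAlg_eval (hm.comp hp) (ht.comp hp) ?_ F)
      (primrec_codeAlg_top (hm.comp hp) (ht.comp hp))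
    rintro (_ | _ | i)
    · exact .comp .snd (.comp .fst .fst)
    · exact .comp .snd .fst
    · exact .snd
  · refine primrecPred_forall_lt hm (primrecPred_imp (Primrec.eq.comp ?_ ?_) (Primrec.eq.comp ?_ ?_))
    · exact primrec_codeAlg_imp (hm.comp .fst) (ht.comp .fst)
        (primrec_codeAlg_top (hm.comp .fst) (ht.comp .fst)) .snd
    · exact primrec_codeAlg_top (hm.comp .fst) (ht.comp .fst)
    · exact .snd
    · exact primrec_codeAlg_top (hm.comp .fst) (ht.comp .fst)
  · exact Primrec.eq.comp (primrec_codeAlg_box hm ht (primrec_codeAlg_top hm ht))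
      (primrec_codeAlg_top hm ht)

include hm ht he hx in
theorem primrecPred_codesEval : PrimrecPred fun a => CodesEval (m a) (t a) (e a) (x a) := by
  refine (Primrec.eq.comp (primrec_digit hm he (.const 0)) (primrec_codeAlg_bot hm ht)).and
    (primrecPred_forall_lt hx ?_)
  have hm' : Primrec fun a : α × ℕ => m a.1 := hm.comp .fst
  have ht' : Primrec fun a : α × ℕ => t a.1 := ht.comp .fst
  have he' : Primrec fun a : α × ℕ => e a.1 := he.comp .fst
  have hdiv : Primrec fun a : α × ℕ => a.2 / 4 := Primrec.nat_div.comp .snd (.const 4)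
  have hmod : ∀ r, PrimrecPred fun a : α × ℕ => a.2 % 4 = r := fun r =>
    Primrec.eq.comp (Primrec.nat_mod.comp .snd (.const 4)) (.const r)
  have hd := primrec_digit hm' he' (Primrec.succ.comp .snd)
  have h₁ := primrec_digit hm' he' (.comp .fst (Primrec.unpair.comp hdiv))
  have h₂ := primrec_digit hm' he' (.comp .snd (Primrec.unpair.comp hdiv))
  exact (primrecPred_imp (hmod 1)
      (Primrec.eq.comp hd (primrec_codeAlg_box hm' ht' (primrec_digit hm' he' hdiv)))).and
    ((primrecPred_imp (hmod 2) (Primrec.eq.comp hd (primrec_codeAlg_imp hm' ht' h₁ h₂))).and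
      (primrecPred_imp (hmod 3) (Primrec.eq.comp hd (primrec_codeAlg_rhd hm' ht' h₁ h₂))))

end Primrec

theorem primrec_classBound : Primrec₂ classBound := by
  have hr : Primrec fun p : ℕ × ℕ × ℕ => p.2.2 := .comp .snd .snd
  have h : Primrec₂ fun (k : ℕ) (p : ℕ × ℕ) => 2 ^ 2 ^ (k + (p.2 + p.2 * p.2)) :=
    primrec_pow (.const 2) (primrec_pow (.const 2) (Primrec.nat_add.comp .fst
      (Primrec.nat_add.comp hr (Primrec.nat_mul.comp hr hr))))
  refine (Primrec.nat_rec (Primrec.const 1) h).of_eq fun k n => ?_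
  induction n with
  | zero => rfl
  | succ n ih => simp only [classBound, ← ih]

theorem primrec_modelBound : Primrec modelBound :=
  primrec_classBound.comp Primrec.succ
    (Primrec.nat_add.comp (Primrec.nat_mul.comp (.const 2) .id) (.const 3))

theorem primrecPred_boundedValid (χ : Formula) : PrimrecPred (BoundedValid χ) := by
  refine primrecPred_forall_lt (Primrec.succ.comp primrec_modelBound)
    (primrecPred_forall_lt ?_ (primrecPred_forall_lt ?_ ?_))
  · exact primrec_pow .snd (Primrec.succ.comp (Primrec.nat_mul.comp (.const 4)
      (primrec_pow .snd (.const 2))))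
  · exact primrec_pow (.comp .snd .fst) (Primrec.succ.comp (.comp .fst .fst))
  · have ha : Primrec fun p : ((ℕ × ℕ) × ℕ) × ℕ => p.1.1.1 := .comp .fst (.comp .fst .fst)
    have hm : Primrec fun p : ((ℕ × ℕ) × ℕ) × ℕ => p.1.1.2 := .comp .snd (.comp .fst .fst)
    have ht : Primrec fun p : ((ℕ × ℕ) × ℕ) × ℕ => p.1.2 := .comp .snd .fst
    have he : Primrec fun p : ((ℕ × ℕ) × ℕ) × ℕ => p.2 := .snd
    exact ((primrecPred_codesModel hm ht χ).and (primrecPred_codesEval hm ht he ha)).not.or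
      (Primrec.eq.comp (primrec_digit hm he ha) (primrec_codeAlg_top hm ht))

/-! ### Decidability of the four logics. -/

/-- A logic axiomatised over **IL** by one scheme that is preserved under relativisation is
decidable. -/
theorem isDecidable_of_rel {X : Set Formula} (χ : Formula) (hX : X = instances χ)
    (hrel : ∀ (k : ℕ) (δ : Formula), ∀ F ∈ X, Provable X (rel k δ F)) :
    IsDecidable (IL X) := by
  subst hX
  have h : PrimrecPred fun A : Formula => BoundedValid χ (Encodable.encode A) :=
    (primrecPred_boundedValid χ).comp Primrec.encode
  obtain ⟨hdec, hp⟩ := h.of_eq fun A =>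
    boundedValid_iff.trans (provable_iff_forall_model (A := A) hrel).symm
  exact ⟨hdec, hp.to_comp⟩

theorem isDecidable_schemeM₀ : IsDecidable (IL schemeM₀) :=
  isDecidable_of_rel
    (((var 0).rhd (var 1)).imp (((var 0).dia.and (var 2).box).rhd ((var 1).and (var 2).box)))
    rfl provable_rel_of_mem_schemeM₀

theorem isDecidable_schemeWstar : IsDecidable (IL schemeWstar) :=
  isDecidable_of_rel
    (((var 0).rhd (var 1)).imp
      (((var 1).and (var 2).box).rhd (((var 1).and (var 2).box).and (var 0).neg.box)))
    rfl provable_rel_of_mem_schemeWstar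

theorem isDecidable_schemeP₀ : IsDecidable (IL schemeP₀) :=
  isDecidable_of_rel (((var 0).rhd (var 1).dia).imp ((var 0).rhd (var 1)).box)
    -- The scheme has only two parameters; `bot` is a dummy third one.
    (Set.ext fun _ => ⟨fun ⟨A, B, h⟩ => ⟨A, B, bot, h⟩, fun ⟨A, B, _, h⟩ => ⟨A, B, h⟩⟩)
    provable_rel_of_mem_schemeP₀

theorem isDecidable_schemeR : IsDecidable (IL schemeR) :=
  isDecidable_of_rel
    (((var 0).rhd (var 1)).imp (((var 0).rhd (var 2).neg).neg.rhd ((var 1).and (var 2).box)))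
    rfl provable_rel_of_mem_schemeR

end IntLogic

theorem mainTheorem10 :
    IntLogic.IsDecidable (IntLogic.IL IntLogic.schemeM₀) ∧
    IntLogic.IsDecidable (IntLogic.IL IntLogic.schemeWstar) ∧
    IntLogic.IsDecidable (IntLogic.IL IntLogic.schemeP₀) ∧
    IntLogic.IsDecidable (IntLogic.IL IntLogic.schemeR) :=
  ⟨IntLogic.isDecidable_schemeM₀, IntLogic.isDecidable_schemeWstar,
    IntLogic.isDecidable_schemeP₀, IntLogic.isDecidable_schemeR⟩
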